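/- For $g\in L^2(\mathbb R)$ let $(g,1,1)$ denote the Weyl--Heisenberg system $(E_mT_ng)_{m,n\in\mathbb Z}$, where $E_mf(x)=e^{2\pi i m x}f(x)$ and $T_nf(x)=f(x-n)$; it is a WH-frame if there are constants $A,B>0$ with $$A\|f\|^2\le\sum_{m,n\in\mathbb Z}|\langle f,E_mT_ng\rangle|^2\le B\|f\|^2\qquad\text{for all } f\in L^2(\mathbb R).$$ For $k\in\mathbb Z$ put $G_k(t)=\sum_{n\in\mathbb Z}g(t-n)\overline{g(t-n-k)}$. There is $g\in L^2(\mathbb R)$ such that $(g,1,1)$ is a WH-frame (the series defining each $G_k$ converges absolutely almost everywhere, and $\overline{f(t)}f(t-k)G_k(t)$ is integrable for all $f\in L^2(\mathbb R)$ and $k\in\mathbb Z$) and the following hold. (i) For every $f\in L^2(\mathbb R)$ the symmetric partial sums below converge and $$\sum_{m,n\in\mathbb Z}|\langle f,E_mT_ng\rangle|^2=\lim_{K\to\infty}\sum_{k=-K}^{K}\int_{\mathbb R}\overline{f(t)}f(t-k)G_k(t)\,dt .$$ (ii) There is $h\in L^2(\mathbb R)$ for which the series does not converge, that is, the limit $$\lim_{K,L\to\infty}\sum_{k=-L}^{K}\int_{\mathbb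 R}\overline{h(t)}h(t-k)G_k(t)\,dt,$$ with $K$ and $L$ tending to infinity independently, does not exist. -/

import Mathlib

open MeasureTheory Filter Topology

noncomputable section

/-- The complex Hilbert space `L²(ℝ)`, with respect to Lebesgue measure. -/
abbrev L2R : Type := Lp ℂ 2 (volume : Measure ℝ)

/-- A family `φ` in a complex Hilbert space is a frame if there are `A, B > 0` with
`A ‖f‖² ≤ ∑ i, |⟨f, φ i⟩|² ≤ B ‖f‖²` for all `f` (the sum being finite). -/
def IsFrame {ι H : Type*} [NormedAddCommGroup H] [InnerProductSpace ℂ H] (φ : ι → H) : Prop :=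
  ∃ A B : ℝ, 0 < A ∧ 0 < B ∧ ∀ f : H,
    Summable (fun i => ‖inner ℂ (φ i) f‖ ^ 2) ∧
    A * ‖f‖ ^ 2 ≤ ∑' i, ‖inner ℂ (φ i) f‖ ^ 2 ∧
    ∑' i, ‖inner ℂ (φ i) f‖ ^ 2 ≤ B * ‖f‖ ^ 2

/-- Translation `(T_a f)(x) = f (x - a)` on `L²(ℝ)`. -/
def translation (a : ℝ) (f : L2R) : L2R :=
  Lp.compMeasurePreserving (fun x : ℝ => x - a) (measurePreserving_sub_right volume a) f

/-- The exponential function `E_a(x) = exp (2 π i a x)`. -/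
def expFun (a x : ℝ) : ℂ := Complex.exp (2 * Real.pi * Complex.I * a * x)

theorem norm_expFun (a x : ℝ) : ‖expFun a x‖ = 1 := by
  have h : (2 * Real.pi * Complex.I * a * x : ℂ) = ((2 * Real.pi * a * x : ℝ) : ℂ) * Complex.I := by
    push_cast; ring
  rw [expFun, h, Complex.norm_exp_ofReal_mul_I]

theorem memLp_expFun_mul (a : ℝ) (f : L2R) : MemLp (fun x => expFun a x * f x) 2 volume := by
  have hc : Continuous (expFun a) := by unfold expFun; fun_prop
  refine (Lp.memLp f).of_le (hc.aestronglyMeasurable.mul (Lp.aestronglyMeasurable f)) ?_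
  exact Eventually.of_forall fun x => by rw [norm_mul, norm_expFun, one_mul]

/-- Modulation `(E_a f)(x) = exp (2 π i a x) f(x)` on `L²(ℝ)`. -/
def modulation (a : ℝ) (f : L2R) : L2R := (memLp_expFun_mul a f).toLp _

/-- The Weyl-Heisenberg system `(g, a, b) = (E_{mb} T_{na} g)`, indexed by `(m, n) ∈ ℤ × ℤ`. -/
def whSystem (g : L2R) (a b : ℝ) (p : ℤ × ℤ) : L2R :=
  modulation (p.1 * b) (translation (p.2 * a) g)

/-- `(g, a, b)` is a WH-frame: the system is a frame for `L²(ℝ)`. -/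
def IsWHFrame (g : L2R) (a b : ℝ) : Prop := IsFrame (whSystem g a b)

/-- The `n`-th term `g(t - n a) * conj (g (t - n a - k / b))` of the series for `G_k(t)`. -/
def walnutTerm (g : L2R) (a b : ℝ) (k : ℤ) (t : ℝ) (n : ℤ) : ℂ :=
  g (t - n * a) * (starRingEnd ℂ) (g (t - n * a - k / b))

/-- `G_k(t) = ∑ n, g(t - n a) * conj (g (t - n a - k / b))`. -/
def walnutG (g : L2R) (a b : ℝ) (k : ℤ) (t : ℝ) : ℂ := ∑' n : ℤ, walnutTerm g a b k t n

/-- The integrand `conj (f(t)) f(t - k/b) G_k(t)` of the WH-frame identity. -/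
def whIntegrand (g : L2R) (a b : ℝ) (f : L2R) (k : ℤ) (t : ℝ) : ℂ :=
  (starRingEnd ℂ) (f t) * f (t - k / b) * walnutG g a b k t

/-- The partial sum over `-L ≤ k ≤ K` of the right hand side of the WH-frame identity. -/
def whPartialSum (g : L2R) (a b : ℝ) (f : L2R) (K L : ℕ) : ℂ :=
  (1 / b : ℂ) * ∑ k ∈ Finset.Icc (-(L : ℤ)) (K : ℤ), ∫ t, whIntegrand g a b f k t

/-- The WH-frame identity holds for `f` with symmetric summation on the right hand side:
the left hand side has a finite sum, to which the symmetric partial sums converge. -/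
def WHIdentitySymm (g : L2R) (a b : ℝ) (f : L2R) : Prop :=
  ∃ s : ℝ, HasSum (fun p : ℤ × ℤ => ‖inner ℂ (whSystem g a b p) f‖ ^ 2) s ∧
    Tendsto (fun K : ℕ => whPartialSum g a b f K K) atTop (𝓝 (s : ℂ))

/-- The right hand side of the WH-frame identity converges for `f`: its partial sums over
`-L ≤ k ≤ K` have a limit as `K` and `L` tend to infinity independently. -/
def WHSeriesConverges (g : L2R) (a b : ℝ) (f : L2R) : Prop :=
  ∃ l : ℂ, Tendsto (fun p : ℕ × ℕ => whPartialSum g a b f p.1 p.2) (atTop ×ˢ atTop) (𝓝 l)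

end

/-! Take for `g` the step function whose value on `[n, n+1)` is the Fourier coefficient `c_n` of a
1-periodic square wave `w` with values 1 and 2. Let `S` be the Fourier multiplier with symbol `w`,
formally `∑ c_j T_j`. Integer translations commute with integer modulations, so the coefficients of
`f` against `(g,1,1)` are those of `S f` against the system of the indicator of `[0,1)`, which
satisfies Parseval's identity. The left side is therefore `‖S f‖²`, and `1 ≤ w ≤ 2` gives the frame
bounds 1 and 4.

Each `G_k` is almost everywhere the constant `∑ c_n conj c_{n-k}`, a Fourier coefficient of `w²`.
Since `w² = 3w - 2` almost everywhere, it equals `3 c_k - 2 δ_{k0}`, and the right side is a Fourier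
series of `w` tested against `f`. Symmetric partial sums of this series are uniformly bounded and
converge pointwise (`exists_abs_oddSine_le`, `tendsto_oddSine`), so dominated convergence gives (i).

For (ii), the coefficients of positive index are `i/(πk)` for odd `k` and zero otherwise, so
one-sided sums diverge logarithmically at the jump. If the series converged for every `h`, uniform
boundedness and polarization would bound the one-sided partial sums in operator norm
(`exists_norm_le_of_inner_self_bounded`); testing on long indicators contradicts this through the
harmonic series. -/

noncomputable section

/-! ### Bounded pointwise convergence of the sine series of a square wave -/

/-- The partial sums of the Fourier sine series of a square wave. -/
def oddSine (n : ℕ) (θ : ℝ) : ℝ :=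
  ∑ j ∈ Finset.range n, Real.sin ((2 * j + 1) * θ) / (2 * j + 1)

theorem abs_sin_nat_mul_le (n : ℕ) (θ : ℝ) : |Real.sin (n * θ)| ≤ n * |Real.sin θ| := by
  induction n with
  | zero => simp
  | succ n ih =>
    have h : ((n + 1 : ℕ) : ℝ) * θ = n * θ + θ := by push_cast; ring
    rw [h, Real.sin_add]
    calc |Real.sin (n * θ) * Real.cos θ + Real.cos (n * θ) * Real.sin θ|
        ≤ |Real.sin (n * θ)| * |Real.cos θ| + |Real.cos (n * θ)| * |Real.sin θ| := by
          rw [← abs_mul, ← abs_mul]; exact abs_add_le _ _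
      _ ≤ |Real.sin (n * θ)| * 1 + 1 * |Real.sin θ| := by
          gcongr <;> exact Real.abs_cos_le_one _
      _ ≤ (n + 1 : ℕ) * |Real.sin θ| := by push_cast; linarith

/-- Each of the `n` terms is at most `|sin θ|`. This controls the region `n |sin θ| ≤ 1` around the
jump. -/
theorem abs_oddSine_le_mul (n : ℕ) (θ : ℝ) : |oddSine n θ| ≤ n * |Real.sin θ| := by
  refine (Finset.abs_sum_le_sum_abs _ _).trans ?_
  calc ∑ j ∈ Finset.range n, |Real.sin ((2 * j + 1) * θ) / (2 * j + 1)|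
      ≤ ∑ _j ∈ Finset.range n, |Real.sin θ| := by
        refine Finset.sum_le_sum fun j _ => ?_
        have hj : (0 : ℝ) < 2 * j + 1 := by positivity
        rw [abs_div, abs_of_pos hj, div_le_iff₀ hj, mul_comm |Real.sin θ|]
        exact_mod_cast abs_sin_nat_mul_le (2 * j + 1) θ
    _ = n * |Real.sin θ| := by simp

theorem hasDerivAt_oddSine (n : ℕ) {θ : ℝ} (hθ : Real.sin θ ≠ 0) :
    HasDerivAt (oddSine n) (Real.sin (2 * n * θ) / (2 * Real.sin θ)) θ := by
  have h1 : HasDerivAt (oddSine n) (∑ j ∈ Finset.range n, Real.cos ((2 * j + 1) * θ)) θ := by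
    unfold oddSine
    refine HasDerivAt.fun_sum fun j _ => ?_
    have hj : (2 * j + 1 : ℝ) ≠ 0 := by positivity
    have := (((hasDerivAt_id θ).const_mul (2 * j + 1 : ℝ)).sin).div_const (2 * j + 1 : ℝ)
    simpa [hj] using this
  convert h1 using 1
  -- Multiplied by `2 sin θ`, the sum of cosines telescopes.
  rw [div_eq_iff (by simpa using hθ)]
  clear h1
  induction n with
  | zero => simp
  | succ n ih =>
    rw [Finset.sum_range_succ, add_mul, ← ih]
    have e1 : 2 * ((n + 1 : ℕ) : ℝ) * θ = (2 * n + 1) * θ + θ := by push_cast; ring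
    have e2 : 2 * (n : ℝ) * θ = (2 * n + 1) * θ - θ := by ring
    rw [e1, e2, Real.sin_add, Real.sin_sub]
    ring

/-- The oscillating correction of `oddSine` by `(cos (2nθ) + a) / (4 n sin θ)`. -/
theorem hasDerivAt_oddSine_add {n : ℕ} (hn : 0 < n) (a : ℝ) {θ : ℝ} (hθ : Real.sin θ ≠ 0) :
    HasDerivAt (fun x => oddSine n x + (Real.cos (2 * n * x) + a) / (4 * n * Real.sin x))
      (-((Real.cos (2 * n * θ) + a) * Real.cos θ) / (4 * n * Real.sin θ ^ 2)) θ := by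
  have hn' : (n : ℝ) ≠ 0 := by positivity
  have h1 : HasDerivAt (fun x : ℝ => Real.cos (2 * n * x) + a)
      (-Real.sin (2 * n * θ) * (2 * n * 1)) θ :=
    (((hasDerivAt_id θ).const_mul (2 * n : ℝ)).cos).add_const a
  have h2 : HasDerivAt (fun x : ℝ => 4 * n * Real.sin x) (4 * n * Real.cos θ) θ :=
    (Real.hasDerivAt_sin θ).const_mul _
  refine ((hasDerivAt_oddSine n hθ).fun_add (h1.fun_div h2 (by positivity))).congr_deriv ?_
  field_simp
  ring

/-- With `a = 1` the corrected function decreases on `(0, π/2]`, with `a = -1` it increases, because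
`cos + a` then has constant sign. Comparing the values at `θ` and `π/2` bounds the difference from
both sides; the correction at `θ` is at most `2 / (4 n sin θ)` in absolute value. -/
theorem abs_oddSine_sub_le_of_mem {n : ℕ} (hn : 0 < n) {θ : ℝ} (h0 : 0 < θ)
    (h1 : θ ≤ Real.pi / 2) :
    |oddSine n θ - oddSine n (Real.pi / 2)| ≤ 1 / (2 * n * Real.sin θ) := by
  have hn' : (0 : ℝ) < n := by positivity
  have hs : ∀ x ∈ Set.Icc θ (Real.pi / 2), 0 < Real.sin x := fun x hx =>
    Real.sin_pos_of_pos_of_lt_pi (h0.trans_le hx.1) (by linarith [hx.2, Real.pi_pos])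
  have hc : ∀ x ∈ Set.Icc θ (Real.pi / 2), 0 ≤ Real.cos x := fun x hx =>
    Real.cos_nonneg_of_mem_Icc ⟨by linarith [hx.1, Real.pi_pos], hx.2⟩
  have hcont : ∀ a : ℝ, ContinuousOn
      (fun x => oddSine n x + (Real.cos (2 * n * x) + a) / (4 * n * Real.sin x))
      (Set.Icc θ (Real.pi / 2)) := fun a x hx =>
    (hasDerivAt_oddSine_add hn a (hs x hx).ne').continuousAt.continuousWithinAt
  have hm1 : θ ∈ Set.Icc θ (Real.pi / 2) := ⟨le_rfl, h1⟩
  have hm2 : Real.pi / 2 ∈ Set.Icc θ (Real.pi / 2) := ⟨h1, le_rfl⟩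
  have anti := antitoneOn_of_deriv_nonpos (convex_Icc θ (Real.pi / 2)) (hcont 1)
    (fun x hx => (hasDerivAt_oddSine_add hn 1
      (hs x (interior_subset hx)).ne').differentiableAt.differentiableWithinAt)
    (fun x hx => by
      have hx' := interior_subset hx
      rw [(hasDerivAt_oddSine_add hn 1 (hs x hx').ne').deriv]
      have := mul_nonneg (by linarith [Real.neg_one_le_cos (2 * n * x)] :
        0 ≤ Real.cos (2 * n * x) + 1) (hc x hx')
      exact div_nonpos_of_nonpos_of_nonneg (by linarith) (by positivity)) hm1 hm2 h1
  have mono := monotoneOn_of_deriv_nonneg (convex_Icc θ (Real.pi / 2)) (hcont (-1))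
    (fun x hx => (hasDerivAt_oddSine_add hn (-1)
      (hs x (interior_subset hx)).ne').differentiableAt.differentiableWithinAt)
    (fun x hx => by
      have hx' := interior_subset hx
      rw [(hasDerivAt_oddSine_add hn (-1) (hs x hx').ne').deriv]
      have := mul_nonneg (by linarith [Real.cos_le_one (2 * n * x)] :
        0 ≤ -(Real.cos (2 * n * x) + -1)) (hc x hx')
      exact div_nonneg (by linarith) (by positivity)) hm1 hm2 h1
  have hsθ := hs θ hm1
  have hpos : 0 < 4 * n * Real.sin θ := by positivity
  have e : 1 / (2 * n * Real.sin θ) = 2 / (4 * n * Real.sin θ) := by field_simp; norm_num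
  have b1 : (Real.cos (2 * n * θ) + 1) / (4 * n * Real.sin θ) ≤ 2 / (4 * n * Real.sin θ) := by
    gcongr; linarith [Real.cos_le_one (2 * n * θ)]
  have b2 : -(2 / (4 * n * Real.sin θ)) ≤ (Real.cos (2 * n * θ) + -1) / (4 * n * Real.sin θ) := by
    rw [← neg_div]; gcongr; linarith [Real.neg_one_le_cos (2 * n * θ)]
  have b3 : 0 ≤ (Real.cos (2 * n * (Real.pi / 2)) + 1) / (4 * n * Real.sin (Real.pi / 2)) := by
    rw [Real.sin_pi_div_two]
    exact div_nonneg (by linarith [Real.neg_one_le_cos (2 * n * (Real.pi / 2))]) (by positivity)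
  have b4 : (Real.cos (2 * n * (Real.pi / 2)) + -1) / (4 * n * Real.sin (Real.pi / 2)) ≤ 0 := by
    rw [Real.sin_pi_div_two]
    exact div_nonpos_of_nonpos_of_nonneg
      (by linarith [Real.cos_le_one (2 * n * (Real.pi / 2))]) (by positivity)
  simp only at anti mono
  rw [e, abs_le]
  constructor <;> linarith

/-- Only odd multiples occur, so the sum is invariant under `θ ↦ π - θ` as well as under the period
`2π`. Together with oddness this reduces every angle to `(0, π/2]`. -/
theorem oddSine_congr {n : ℕ} {x y : ℝ} (h : Real.sin x = Real.sin y) :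
    oddSine n x = oddSine n y := by
  unfold oddSine
  refine Finset.sum_congr rfl fun j _ => ?_
  congr 1
  rcases Real.sin_eq_sin_iff.1 h with ⟨k, hk | hk⟩
  · rw [hk, show (2 * (j : ℝ) + 1) * (2 * k * Real.pi + x)
      = (2 * j + 1) * x + ((k * (2 * j + 1) : ℤ) : ℝ) * (2 * Real.pi) by push_cast; ring,
      Real.sin_add_int_mul_two_pi]
  · rw [hk, show (2 * (j : ℝ) + 1) * ((2 * k + 1) * Real.pi - x)
      = Real.pi - (2 * j + 1) * x + ((2 * k * j + k + j : ℤ) : ℝ) * (2 * Real.pi) by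
        push_cast; ring,
      Real.sin_add_int_mul_two_pi, Real.sin_pi_sub]

theorem oddSine_neg (n : ℕ) (x : ℝ) : oddSine n (-x) = -oddSine n x := by
  simp [oddSine, neg_div]

theorem abs_oddSine_sub_le {n : ℕ} (hn : 0 < n) {θ : ℝ} (hθ : Real.sin θ ≠ 0) :
    |oddSine n θ - Real.sign (Real.sin θ) * oddSine n (Real.pi / 2)|
      ≤ 1 / (2 * n * |Real.sin θ|) := by
  have key : ∀ s : ℝ, 0 < s → s ≤ 1 → ∃ φ, Real.sin φ = s ∧
      |oddSine n φ - oddSine n (Real.pi / 2)| ≤ 1 / (2 * n * s) := fun s h0 h1 => by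
    have hs : Real.sin (Real.arcsin s) = s := Real.sin_arcsin (by linarith) h1
    refine ⟨Real.arcsin s, hs, ?_⟩
    have := abs_oddSine_sub_le_of_mem hn (Real.arcsin_pos.2 h0) (Real.arcsin_le_pi_div_two s)
    rwa [hs] at this
  rcases hθ.lt_or_gt with h | h
  · obtain ⟨φ, hφ, hb⟩ := key (-Real.sin θ) (by linarith) (by linarith [Real.neg_one_le_sin θ])
    have e : oddSine n θ = -oddSine n φ := by
      rw [← oddSine_neg]; exact oddSine_congr (by rw [Real.sin_neg, hφ, neg_neg])
    rw [Real.sign_of_neg h, abs_of_neg h, e]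
    calc _ = |oddSine n φ - oddSine n (Real.pi / 2)| := by rw [← abs_neg]; congr 1; ring
      _ ≤ _ := hb
  · obtain ⟨φ, hφ, hb⟩ := key (Real.sin θ) h (Real.sin_le_one θ)
    rw [Real.sign_of_pos h, abs_of_pos h, oddSine_congr hφ.symm, one_mul]
    exact hb

/-- At `π/2` the sum is the Leibniz series. -/
theorem tendsto_oddSine_pi_div_two :
    Tendsto (fun n => oddSine n (Real.pi / 2)) atTop (𝓝 (Real.pi / 4)) := by
  convert Real.tendsto_sum_pi_div_four using 3 with n
  refine Finset.sum_congr rfl fun j _ => ?_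
  rw [show (2 * (j : ℝ) + 1) * (Real.pi / 2) = Real.pi / 2 + j * Real.pi by ring,
    Real.sin_add_nat_mul_pi, Real.sin_pi_div_two, mul_one]

theorem tendsto_oddSine (θ : ℝ) :
    Tendsto (fun n => oddSine n θ) atTop (𝓝 (Real.sign (Real.sin θ) * (Real.pi / 4))) := by
  by_cases hθ : Real.sin θ = 0
  · have h : ∀ n, oddSine n θ = 0 := fun n => by
      have := abs_oddSine_le_mul n θ
      rw [hθ, abs_zero, mul_zero] at this
      exact abs_eq_zero.1 (le_antisymm this (abs_nonneg _))
    simp [h, hθ]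
  · have h1 : Tendsto (fun n : ℕ => oddSine n θ -
        Real.sign (Real.sin θ) * oddSine n (Real.pi / 2)) atTop (𝓝 0) := by
      have hlim : Tendsto (fun n : ℕ => 1 / (2 * n * |Real.sin θ|)) atTop (𝓝 0) := by
        have h2 : Tendsto (fun n : ℕ => (2 * |Real.sin θ|) * (n : ℝ)) atTop atTop :=
          tendsto_natCast_atTop_atTop.const_mul_atTop (by positivity)
        refine (tendsto_inv_atTop_zero.comp h2).congr fun n => ?_
        simp only [Function.comp, one_div]
        congr 1; ring
      refine squeeze_zero_norm' ?_ hlim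
      filter_upwards [eventually_gt_atTop 0] with n hn
      exact abs_oddSine_sub_le hn hθ
    have h2 := h1.add (tendsto_oddSine_pi_div_two.const_mul (Real.sign (Real.sin θ)))
    simpa using h2

/-- Near the jump, where `n |sin θ| ≤ 1`, the termwise bound suffices; elsewhere the distance to `±
oddSine n (π/2)` is at most 1. -/
theorem exists_abs_oddSine_le : ∃ C : ℝ, ∀ n θ, |oddSine n θ| ≤ C := by
  obtain ⟨C, hC⟩ := tendsto_oddSine_pi_div_two.norm.bddAbove_range
  refine ⟨C + 1, fun n θ => ?_⟩
  have hC' : ∀ n, |oddSine n (Real.pi / 2)| ≤ C := fun n => hC ⟨n, rfl⟩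
  have hC0 : 0 ≤ C := (abs_nonneg _).trans (hC' 0)
  by_cases h : n * |Real.sin θ| ≤ 1
  · linarith [abs_oddSine_le_mul n θ]
  · push Not at h
    have hn : 0 < n := Nat.pos_of_ne_zero fun hn => by
      rw [hn, Nat.cast_zero, zero_mul] at h; linarith
    have hθ : Real.sin θ ≠ 0 := fun hθ => by
      rw [hθ, abs_zero, mul_zero] at h; linarith
    have h1 := abs_oddSine_sub_le hn hθ
    have h2 : 1 / (2 * n * |Real.sin θ|) ≤ 1 := by
      rw [div_le_one (by positivity)]; nlinarith
    have h3 : |Real.sign (Real.sin θ) * oddSine n (Real.pi / 2)| ≤ C := by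
      rw [abs_mul]
      have : |Real.sign (Real.sin θ)| ≤ 1 := by
        rcases Real.sign_apply_eq (Real.sin θ) with h | h | h <;> simp [h]
      calc _ ≤ 1 * |oddSine n (Real.pi / 2)| := by gcongr
        _ ≤ C := by rw [one_mul]; exact hC' n
    have := abs_sub_abs_le_abs_sub (oddSine n θ) (Real.sign (Real.sin θ) * oddSine n (Real.pi / 2))
    linarith

/-! ### The square wave and its Fourier coefficients -/

/-- The square wave `(3 + sign (sin 2πξ)) / 2`, with values `2` and `1`. -/
def sqWave (ξ : ℝ) : ℝ := 3 / 2 + Real.sign (Real.sin (2 * Real.pi * ξ)) / 2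

/-- The Fourier coefficients of `sqWave`. -/
def sqCoeff (k : ℤ) : ℂ :=
  if k = 0 then 3 / 2 else if Odd k then Complex.I / (Real.pi * k) else 0

/-- The symmetric partial sums of the Fourier series of `sqWave`. -/
def sqPartial (N : ℕ) (ξ : ℝ) : ℂ :=
  ∑ j ∈ Finset.Icc (-(N : ℤ)) N, sqCoeff j * expFun (-j) ξ

theorem continuous_expFun (a : ℝ) : Continuous (expFun a) := by unfold expFun; fun_prop

theorem expFun_zero (x : ℝ) : expFun 0 x = 1 := by simp [expFun]

theorem expFun_add (a b x : ℝ) : expFun (a + b) x = expFun a x * expFun b x := by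
  rw [expFun, expFun, expFun, ← Complex.exp_add]; congr 1; push_cast; ring

theorem conj_expFun (a x : ℝ) : (starRingEnd ℂ) (expFun a x) = expFun (-a) x := by
  rw [expFun, expFun, ← Complex.exp_conj]; congr 1; simp [map_ofNat]

theorem expFun_neg_sub_expFun (a x : ℝ) :
    Complex.I * (expFun (-a) x - expFun a x) = (2 * Real.sin (a * (2 * Real.pi * x)) : ℝ) := by
  push_cast
  rw [Complex.sin, expFun, expFun]
  have e1 : 2 * (Real.pi : ℂ) * Complex.I * ((-a : ℝ) : ℂ) * x
    = -(a * (2 * Real.pi * x)) * Complex.I := by push_cast; ring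
  have e2 : 2 * (Real.pi : ℂ) * Complex.I * (a : ℂ) * x
    = (a * (2 * Real.pi * x)) * Complex.I := by ring
  rw [e1, e2]; ring

/-- For odd `k` the terms `±k` combine to `2 sin(2πkξ) / (πk)`, and nonzero even `k` contribute
nothing; `(N + 1) / 2` counts the odd numbers up to `N`. -/
theorem sqPartial_eq (N : ℕ) (ξ : ℝ) :
    sqPartial N ξ
      = ((3 / 2 + 2 / Real.pi * oddSine ((N + 1) / 2) (2 * Real.pi * ξ) : ℝ) : ℂ) := by
  induction N with
  | zero => simp [sqPartial, sqCoeff, oddSine, expFun_zero]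
  | succ N ih =>
    have hstep : sqPartial (N + 1) ξ = sqCoeff (N + 1) * expFun (-(N + 1 : ℤ) : ℤ) ξ
        + sqCoeff (-(N + 1)) * expFun (N + 1 : ℤ) ξ + sqPartial N ξ := by
      unfold sqPartial
      push_cast
      rw [Finset.sum_Icc_succ_eq_add_endpoints]
      push_cast
      simp
    have h0 : (N + 1 : ℤ) ≠ 0 := by omega
    have h0' : (-(N + 1) : ℤ) ≠ 0 := by omega
    rw [hstep, ih]
    rcases Nat.even_or_odd N with hN | hN
    · have hodd : Odd (N + 1 : ℤ) := by exact_mod_cast hN.add_one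
      rw [sqCoeff, sqCoeff, if_neg h0, if_neg h0', if_pos hodd, if_pos hodd.neg]
      obtain ⟨m, rfl⟩ := hN
      have e1 : (m + m + 1) / 2 = m := by omega
      have e2 : (m + m + 1 + 1) / 2 = m + 1 := by omega
      rw [e1, e2, show oddSine (m + 1) (2 * Real.pi * ξ) = _ from Finset.sum_range_succ _ m]
      rw [show ∑ j ∈ Finset.range m, Real.sin ((2 * j + 1) * (2 * Real.pi * ξ)) / (2 * j + 1)
        = oddSine m (2 * Real.pi * ξ) from rfl]
      have h := expFun_neg_sub_expFun (2 * m + 1) ξ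
      have hm : (2 * (m : ℂ) + 1) ≠ 0 := by exact_mod_cast (by omega : 2 * m + 1 ≠ 0)
      have hpi : (Real.pi : ℂ) ≠ 0 := by exact_mod_cast Real.pi_ne_zero
      have e3 : (((-(((m + m : ℕ) : ℤ) + 1) : ℤ)) : ℝ) = -(2 * m + 1) := by push_cast; ring
      have e4 : (((((m + m : ℕ) : ℤ) + 1 : ℤ)) : ℝ) = (2 * m + 1) := by push_cast; ring
      rw [e3, e4]
      push_cast at h ⊢
      have h' : expFun (-(2 * m + 1)) ξ * Complex.I
        = 2 * Complex.sin ((2 * m + 1) * (2 * Real.pi * ξ)) + Complex.I * expFun (2 * m + 1) ξ := by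
        rw [← h]; ring
      have e5 : (m : ℂ) + m + 1 = 2 * m + 1 := by ring
      rw [e5]
      generalize Complex.sin ((2 * m + 1) * (2 * Real.pi * ξ)) = s at h' ⊢
      field_simp
      linear_combination 2 * h'
    · have heven : ¬ Odd (N + 1 : ℤ) := by
        rw [Int.not_odd_iff_even]; exact_mod_cast hN.add_one
      have heven' : ¬ Odd (-(N + 1) : ℤ) := by rwa [odd_neg]
      rw [sqCoeff, sqCoeff, if_neg h0, if_neg h0', if_neg heven, if_neg heven']
      obtain ⟨m, rfl⟩ := hN
      have e1 : (2 * m + 1 + 1) / 2 = m + 1 := by omega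
      have e2 : (2 * m + 1 + 1 + 1) / 2 = m + 1 := by omega
      rw [e1, e2]; simp

theorem tendsto_sqPartial (ξ : ℝ) :
    Tendsto (fun N => sqPartial N ξ) atTop (𝓝 (sqWave ξ : ℂ)) := by
  simp_rw [sqPartial_eq]
  refine (Complex.continuous_ofReal.tendsto _).comp ?_
  have hN : Tendsto (fun N : ℕ => (N + 1) / 2) atTop atTop :=
    tendsto_atTop_atTop.2 fun b => ⟨2 * b, fun a ha => by omega⟩
  have h := (((tendsto_oddSine (2 * Real.pi * ξ)).comp hN).const_mul (2 / Real.pi)).const_add (3 / 2)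
  convert! h using 2
  rw [sqWave]
  field_simp
  ring

theorem exists_norm_sqPartial_le : ∃ C : ℝ, ∀ N ξ, ‖sqPartial N ξ‖ ≤ C := by
  obtain ⟨C, hC⟩ := exists_abs_oddSine_le
  refine ⟨3 / 2 + 2 / Real.pi * C, fun N ξ => ?_⟩
  rw [sqPartial_eq, Complex.norm_real, Real.norm_eq_abs]
  refine (abs_add_le _ _).trans ?_
  rw [abs_mul, abs_of_pos (by positivity : (0 : ℝ) < 3 / 2),
    abs_of_pos (by positivity : (0 : ℝ) < 2 / Real.pi)]
  gcongr
  exact hC _ _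

theorem continuous_sqPartial (N : ℕ) : Continuous (sqPartial N) := by
  unfold sqPartial
  exact continuous_finsetSum _ fun j _ => continuous_const.mul (continuous_expFun _)

theorem measurable_sqWave : Measurable sqWave := by
  have h : Measurable (fun ξ => (sqWave ξ : ℂ)) :=
    measurable_of_tendsto_metrizable (fun N => (continuous_sqPartial N).measurable)
      (tendsto_pi_nhds.2 tendsto_sqPartial)
  exact Complex.measurable_re.comp h

theorem one_le_sqWave (ξ : ℝ) : 1 ≤ sqWave ξ := by
  rw [sqWave]
  rcases Real.sign_apply_eq (Real.sin (2 * Real.pi * ξ)) with h | h | h <;> rw [h] <;> norm_num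

theorem sqWave_le_two (ξ : ℝ) : sqWave ξ ≤ 2 := by
  rw [sqWave]
  rcases Real.sign_apply_eq (Real.sin (2 * Real.pi * ξ)) with h | h | h <;> rw [h] <;> norm_num

/-- The values 1 and 2 are the roots of `X² = 3X - 2`. The value `3/2` occurs only on the countable
zero set of the sine. -/
theorem sqWave_sq : ∀ᵐ ξ : ℝ, sqWave ξ ^ 2 = 3 * sqWave ξ - 2 := by
  have hc : Set.Countable {ξ : ℝ | Real.sin (2 * Real.pi * ξ) = 0} := by
    refine (Set.countable_range fun n : ℤ => (n : ℝ) / 2).mono fun ξ hξ => ?_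
    obtain ⟨n, hn⟩ := Real.sin_eq_zero_iff.1 hξ
    refine ⟨n, ?_⟩
    have : Real.pi * (n - 2 * ξ) = 0 := by linear_combination hn
    rcases mul_eq_zero.1 this with h | h
    · exact absurd h Real.pi_ne_zero
    · simp only; linarith
  filter_upwards [hc.ae_notMem volume] with ξ hξ
  rw [sqWave]
  rcases lt_or_gt_of_ne (show Real.sin (2 * Real.pi * ξ) ≠ 0 from hξ) with h | h
  · rw [Real.sign_of_neg h]; norm_num
  · rw [Real.sign_of_pos h]; norm_num

theorem conj_sqCoeff (k : ℤ) : (starRingEnd ℂ) (sqCoeff k) = sqCoeff (-k) := by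
  unfold sqCoeff
  by_cases h : k = 0
  · simp [h, map_ofNat]
  · by_cases h' : Odd k
    · simp [h, h', neg_div, div_neg]
    · simp [h, h']

theorem norm_sqCoeff_sq_le (k : ℤ) :
    ‖sqCoeff k‖ ^ 2 ≤ 1 / (k : ℝ) ^ 2 + if k = 0 then 9 / 4 else 0 := by
  unfold sqCoeff
  by_cases h : k = 0
  · simp [h]; norm_num
  · by_cases h' : Odd k
    · simp only [h, h', if_true, if_false, add_zero, norm_div, norm_mul, Complex.norm_I,
        Complex.norm_real, Complex.norm_intCast, div_pow, one_pow, mul_pow, Real.norm_eq_abs, sq_abs]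
      have hk0 : (k : ℝ) ≠ 0 := by exact_mod_cast h
      have hk : (0 : ℝ) < (k : ℝ) ^ 2 := by positivity
      have hpi : 1 ≤ Real.pi ^ 2 := by nlinarith [Real.pi_gt_three]
      exact one_div_le_one_div_of_le hk (by nlinarith)
    · simp only [h, h', if_false, norm_zero]
      have := sq_nonneg (k : ℝ)
      simpa using this

theorem summable_norm_sqCoeff_sq : Summable fun k => ‖sqCoeff k‖ ^ 2 := by
  refine Summable.of_nonneg_of_le (fun k => by positivity) norm_sqCoeff_sq_le ?_
  refine (Real.summable_one_div_int_pow.2 one_lt_two).add ?_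
  exact summable_of_ne_finset_zero (s := {0}) fun k hk => by simp at hk; simp [hk]

theorem integral_expFun_int (k : ℤ) :
    ∫ x in (0 : ℝ)..1, expFun k x = if k = 0 then 1 else 0 := by
  by_cases h : k = 0
  · simp [h, expFun_zero]
  · rw [if_neg h]
    have hc : 2 * (Real.pi : ℂ) * Complex.I * k ≠ 0 := by
      simp [h, Real.pi_ne_zero, Complex.I_ne_zero]
    have := integral_exp_mul_complex (a := 0) (b := 1) hc
    simp only [expFun, Complex.ofReal_intCast]
    rw [this]
    have e : Complex.exp (2 * Real.pi * Complex.I * k * (1 : ℝ)) = 1 := by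
      rw [Complex.exp_eq_one_iff]; exact ⟨k, by push_cast; ring⟩
    rw [e]; simp

theorem tendsto_integral_sqPartial_mul {u : ℝ → ℂ} {C : ℝ} (hu : Measurable u)
    (hC : ∀ x, ‖u x‖ ≤ C) :
    Tendsto (fun N => ∫ x in (0 : ℝ)..1, sqPartial N x * u x) atTop
      (𝓝 (∫ x in (0 : ℝ)..1, sqWave x * u x)) := by
  obtain ⟨D, hD⟩ := exists_norm_sqPartial_le
  refine intervalIntegral.tendsto_integral_filter_of_dominated_convergence (fun _ => D * C)
    ?_ ?_ ?_ ?_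
  · exact Eventually.of_forall fun N =>
      ((continuous_sqPartial N).measurable.mul hu).aestronglyMeasurable
  · refine Eventually.of_forall fun N => Eventually.of_forall fun x _ => ?_
    rw [norm_mul]
    exact mul_le_mul (hD N x) (hC x) (norm_nonneg _) ((norm_nonneg _).trans (hD N x))
  · exact intervalIntegrable_const
  · exact Eventually.of_forall fun x _ => (tendsto_sqPartial x).mul_const _

theorem integral_sqPartial_mul {u : ℝ → ℂ} {C : ℝ} (hu : Measurable u)
    (hC : ∀ x, ‖u x‖ ≤ C) (N : ℕ) :
    ∫ x in (0 : ℝ)..1, sqPartial N x * u x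
      = ∑ j ∈ Finset.Icc (-(N : ℤ)) N, sqCoeff j * ∫ x in (0 : ℝ)..1, expFun (-j) x * u x := by
  simp only [sqPartial, Finset.sum_mul]
  rw [intervalIntegral.integral_finsetSum]
  · refine Finset.sum_congr rfl fun j _ => ?_
    rw [← intervalIntegral.integral_const_mul]
    simp only [mul_assoc]
  · intro j _
    refine (intervalIntegrable_const (c := ‖sqCoeff j‖ * C)).mono_fun
      (((continuous_expFun _).measurable.const_mul _).mul hu).aestronglyMeasurable ?_
    refine Eventually.of_forall fun x => ?_
    simp only [norm_mul, norm_expFun, mul_one]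
    rw [norm_norm]
    gcongr
    exact (hC x).trans (le_abs_self C)

/-- The partial sums may be integrated against a character by bounded convergence, and orthogonality
makes these integrals constant once `N ≥ |k|`. -/
theorem integral_sqWave_mul_expFun (k : ℤ) :
    ∫ x in (0 : ℝ)..1, sqWave x * expFun k x = sqCoeff k := by
  have hu : Measurable (expFun k) := (continuous_expFun _).measurable
  have hC : ∀ x, ‖expFun k x‖ ≤ 1 := fun x => (norm_expFun _ _).le
  refine tendsto_nhds_unique (tendsto_integral_sqPartial_mul hu hC) ?_
  refine tendsto_const_nhds.congr' ?_
  filter_upwards [eventually_ge_atTop k.natAbs] with N hN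
  rw [integral_sqPartial_mul hu hC]
  have : ∀ j : ℤ, ∫ x in (0 : ℝ)..1, expFun (-j) x * expFun k x = if j = k then 1 else 0 := by
    intro j
    have e : ∀ x, expFun (-j) x * expFun k x = expFun ((k - j : ℤ) : ℝ) x := fun x => by
      rw [← expFun_add]; congr 1; push_cast; ring
    simp_rw [e, integral_expFun_int, sub_eq_zero, eq_comm]
  simp_rw [this]
  rw [Finset.sum_eq_single k]
  · simp
  · intro j _ hj; simp [hj]
  · intro hk; exact absurd (Finset.mem_Icc.2 (by omega)) hk

theorem summable_sqCoeff_mul_conj (k : ℤ) :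
    Summable fun n => sqCoeff n * (starRingEnd ℂ) (sqCoeff (n - k)) := by
  refine Summable.of_norm_bounded (g := fun n => ‖sqCoeff n‖ ^ 2 + ‖sqCoeff (n - k)‖ ^ 2) ?_ ?_
  · exact summable_norm_sqCoeff_sq.add
      (summable_norm_sqCoeff_sq.comp_injective (sub_left_injective (b := k)))
  · intro n
    rw [norm_mul, RCLike.norm_conj]
    nlinarith [sq_nonneg (‖sqCoeff n‖ - ‖sqCoeff (n - k)‖), norm_nonneg (sqCoeff n),
      norm_nonneg (sqCoeff (n - k)), sq_nonneg (‖sqCoeff n‖), sq_nonneg ‖sqCoeff (n - k)‖]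

/-- The autocorrelation of the coefficients of a square wave with values `1` and `2`. -/
theorem tsum_sqCoeff_mul_conj (k : ℤ) :
    ∑' n, sqCoeff n * (starRingEnd ℂ) (sqCoeff (n - k))
      = 3 * sqCoeff k - if k = 0 then 2 else 0 := by
  have hu : Measurable fun x => (sqWave x : ℂ) * expFun k x :=
    (Complex.measurable_ofReal.comp measurable_sqWave).mul (continuous_expFun _).measurable
  have hW : ∀ x, ‖(sqWave x : ℂ)‖ ≤ 2 := fun x => by
    rw [Complex.norm_real, Real.norm_eq_abs, abs_le]
    constructor <;> linarith [one_le_sqWave x, sqWave_le_two x]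
  have hC : ∀ x, ‖(sqWave x : ℂ) * expFun k x‖ ≤ 2 := fun x => by
    rw [norm_mul, norm_expFun, mul_one]; exact hW x
  have h1 := tendsto_integral_sqPartial_mul hu hC
  replace h1 := h1.congr (integral_sqPartial_mul hu hC)
  have e : ∀ j : ℤ, ∫ x in (0 : ℝ)..1, expFun (-j) x * (sqWave x * expFun k x)
      = (starRingEnd ℂ) (sqCoeff (j - k)) := fun j => by
    rw [conj_sqCoeff, ← integral_sqWave_mul_expFun]
    refine intervalIntegral.integral_congr fun x _ => ?_
    rw [mul_left_comm, ← expFun_add]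
    congr 2; push_cast; ring
  simp_rw [e] at h1
  -- The absolutely convergent series has the same value along symmetric intervals, where it can be
  -- compared with `h1`.
  have h2 := SummationFilter.hasSum_symmetricIcc_iff.1
    ((summable_sqCoeff_mul_conj k).hasSum.mono_left SummationFilter.LeAtTop.le_atTop)
  rw [tendsto_nhds_unique h2 h1]
  have hi : IntervalIntegrable (fun x => (sqWave x : ℂ) * expFun k x) volume 0 1 :=
    (intervalIntegrable_const (c := (2 : ℝ))).mono_fun hu.aestronglyMeasurable
      (Eventually.of_forall fun x => by simpa using hC x)
  have hi' : IntervalIntegrable (expFun k) volume 0 1 :=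
    (continuous_expFun k).intervalIntegrable _ _
  have h3 : ∫ x in (0 : ℝ)..1, sqWave x * (sqWave x * expFun k x)
      = ∫ x in (0 : ℝ)..1, (3 * (sqWave x * expFun k x) - 2 * expFun k x) := by
    refine intervalIntegral.integral_congr_ae ?_
    filter_upwards [sqWave_sq] with x hx _
    have hx' : (sqWave x : ℂ) ^ 2 = 3 * sqWave x - 2 := by exact_mod_cast hx
    linear_combination expFun k x * hx'
  rw [h3, intervalIntegral.integral_sub (hi.const_mul 3) (hi'.const_mul 2),
    intervalIntegral.integral_const_mul, intervalIntegral.integral_const_mul,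
    integral_sqWave_mul_expFun, integral_expFun_int]
  split_ifs <;> simp

/-! ### Translation, modulation and the Fourier transform on `L²(ℝ)` -/

theorem translation_coeFn (a : ℝ) (f : L2R) : translation a f =ᵐ[volume] fun x => f (x - a) :=
  Lp.coeFn_compMeasurePreserving f (measurePreserving_sub_right volume a)

theorem modulation_coeFn (a : ℝ) (f : L2R) :
    modulation a f =ᵐ[volume] fun x => expFun a x * f x :=
  (memLp_expFun_mul a f).coeFn_toLp

theorem inner_modulation (a : ℝ) (f g : L2R) :
    inner ℂ (modulation a f) (modulation a g) = inner ℂ f g := by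
  rw [L2.inner_def, L2.inner_def]
  refine integral_congr_ae ?_
  filter_upwards [modulation_coeFn a f, modulation_coeFn a g] with x hf hg
  rw [hf, hg, RCLike.inner_apply, RCLike.inner_apply, map_mul, conj_expFun]
  have h : expFun a x * expFun (-a) x = 1 := by rw [← expFun_add, add_neg_cancel, expFun_zero]
  linear_combination (g x * (starRingEnd ℂ) (f x)) * h

theorem modulation_sub (a : ℝ) (f g : L2R) :
    modulation a (f - g) = modulation a f - modulation a g := by
  refine Lp.ext ?_
  filter_upwards [modulation_coeFn a (f - g), modulation_coeFn a f, modulation_coeFn a g,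
    Lp.coeFn_sub f g, Lp.coeFn_sub (modulation a f) (modulation a g)] with x h1 h2 h3 h4 h5
  rw [h1, h5, Pi.sub_apply, h2, h3, h4, Pi.sub_apply, mul_sub]

theorem norm_modulation (a : ℝ) (f : L2R) : ‖modulation a f‖ = ‖f‖ := by
  rw [@norm_eq_sqrt_re_inner ℂ, @norm_eq_sqrt_re_inner ℂ _ _ _ _ f, inner_modulation]

theorem continuous_modulation (a : ℝ) : Continuous (modulation a) := by
  refine (Isometry.of_dist_eq fun f g => ?_).continuous
  rw [dist_eq_norm, dist_eq_norm, ← modulation_sub, norm_modulation]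

theorem continuous_translation (a : ℝ) : Continuous (translation a) :=
  (Lp.isometry_compMeasurePreserving (measurePreserving_sub_right volume a)).continuous

open FourierTransform in
theorem fourier_comp_sub_right (f : ℝ → ℂ) (a ξ : ℝ) :
    𝓕 (fun x => f (x - a)) ξ = expFun (-a) ξ * 𝓕 f ξ := by
  rw [Real.fourier_eq, Real.fourier_eq, ← integral_const_mul]
  refine Eq.trans ?_ (integral_sub_right_eq_self _ a)
  refine integral_congr_ae (Eventually.of_forall fun x => ?_)
  simp only [Circle.smul_def, Real.fourierChar_apply, smul_eq_mul, ← mul_assoc]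
  congr 1
  rw [expFun, ← Complex.exp_add]
  congr 1
  simp
  ring

open FourierTransform in
theorem fourier_translation (a : ℝ) (f : L2R) :
    𝓕 (translation a f) = modulation (-a) (𝓕 f) := by
  refine DenseRange.induction_on (p := fun f : L2R => 𝓕 (translation a f) = modulation (-a) (𝓕 f))
    (SchwartzMap.denseRange_toLpCLM (p := 2) ENNReal.ofNat_ne_top) f ?_ ?_
  · exact isClosed_eq (continuous_fourier.comp (continuous_translation a))
      ((continuous_modulation _).comp continuous_fourier)
  · intro φ
    have h1 : translation a (φ.toLp 2) = (φ.compSubConstCLM ℂ a).toLp 2 := by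
      refine Lp.ext ?_
      have h := (measurePreserving_sub_right volume a).quasiMeasurePreserving.ae
        (SchwartzMap.coeFn_toLp φ 2 volume)
      filter_upwards [translation_coeFn a (φ.toLp 2), h,
        SchwartzMap.coeFn_toLp (φ.compSubConstCLM ℂ a) 2 volume] with x h1 h2 h3
      rw [h1, h3, h2]; rfl
    change 𝓕 (translation a (φ.toLp 2)) = modulation (-a) (𝓕 (φ.toLp 2))
    rw [h1, SchwartzMap.toLp_fourier_eq, SchwartzMap.toLp_fourier_eq]
    refine Lp.ext ?_
    filter_upwards [modulation_coeFn (-a) ((𝓕 φ).toLp 2), SchwartzMap.coeFn_toLp (𝓕 φ) 2 volume,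
      SchwartzMap.coeFn_toLp (𝓕 (φ.compSubConstCLM ℂ a)) 2 volume] with x h1 h2 h3
    rw [h1, h3, h2, SchwartzMap.fourier_coe, SchwartzMap.fourier_coe, ← fourier_comp_sub_right]
    rfl

/-! ### The multiplier with symbol the square wave -/

theorem norm_sqWave_mul_le (f : L2R) (x : ℝ) : ‖(sqWave x : ℂ) * f x‖ ≤ 2 * ‖f x‖ := by
  rw [norm_mul, Complex.norm_real, Real.norm_eq_abs,
    abs_of_nonneg (zero_le_one.trans (one_le_sqWave x))]
  gcongr
  exact sqWave_le_two x

theorem memLp_sqWave_mul (f : L2R) : MemLp (fun x => (sqWave x : ℂ) * f x) 2 volume :=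
  (Lp.memLp f).of_le_mul
    ((Complex.measurable_ofReal.comp measurable_sqWave).aestronglyMeasurable.mul
      (Lp.aestronglyMeasurable f)) (Eventually.of_forall (norm_sqWave_mul_le f))

/-- Multiplication by `sqWave` on `L²(ℝ)`. -/
def sqMul (f : L2R) : L2R := (memLp_sqWave_mul f).toLp _

theorem sqMul_coeFn (f : L2R) : sqMul f =ᵐ[volume] fun x => (sqWave x : ℂ) * f x :=
  (memLp_sqWave_mul f).coeFn_toLp

theorem norm_sqMul_le (f : L2R) : ‖sqMul f‖ ≤ 2 * ‖f‖ := by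
  refine Lp.norm_le_mul_norm_of_ae_le_mul ?_
  filter_upwards [sqMul_coeFn f] with x hx
  rw [hx]; exact norm_sqWave_mul_le f x

theorem norm_le_norm_sqMul (f : L2R) : ‖f‖ ≤ ‖sqMul f‖ := by
  refine Lp.norm_le_norm_of_ae_le ?_
  filter_upwards [sqMul_coeFn f] with x hx
  rw [hx, norm_mul, Complex.norm_real, Real.norm_eq_abs]
  exact le_mul_of_one_le_left (norm_nonneg _) ((one_le_sqWave x).trans (le_abs_self _))

theorem inner_sqMul (f g : L2R) :
    inner ℂ f (sqMul g) = ∫ x, (sqWave x : ℂ) * inner ℂ (f x) (g x) := by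
  rw [L2.inner_def]
  refine integral_congr_ae ?_
  filter_upwards [sqMul_coeFn g] with x hx
  rw [hx, RCLike.inner_apply, RCLike.inner_apply, mul_assoc]

theorem integrable_sqWave_mul_inner (f g : L2R) :
    Integrable fun x => (sqWave x : ℂ) * inner ℂ (f x) (g x) := by
  refine (L2.integrable_inner f (sqMul g)).congr ?_
  filter_upwards [sqMul_coeFn g] with x hx
  rw [hx, RCLike.inner_apply, RCLike.inner_apply, mul_assoc]

/-- The quadratic relation for `sqWave` makes the squared norm linear in the symbol, so only partial
sums of `sqWave` itself are needed later. -/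
theorem inner_sqMul_sqMul (f : L2R) :
    inner ℂ (sqMul f) (sqMul f) = 3 * inner ℂ f (sqMul f) - 2 * inner ℂ f f := by
  rw [inner_sqMul f f, L2.inner_def, L2.inner_def f f, ← integral_const_mul,
    ← integral_const_mul, ← integral_sub ((integrable_sqWave_mul_inner f f).const_mul 3)
      ((L2.integrable_inner f f).const_mul 2)]
  refine integral_congr_ae ?_
  filter_upwards [sqMul_coeFn f, sqWave_sq] with x hx h2
  have h2' : (sqWave x : ℂ) ^ 2 = 3 * sqWave x - 2 := by exact_mod_cast h2
  rw [hx, RCLike.inner_apply, RCLike.inner_apply, map_mul, Complex.conj_ofReal]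
  linear_combination (f x * (starRingEnd ℂ) (f x)) * h2'

/-- Symmetric summation is essential here: the uniform bound on `sqPartial` supplies the dominating
function. -/
theorem tendsto_sum_inner_modulation (f g : L2R) :
    Tendsto (fun N : ℕ => ∑ j ∈ Finset.Icc (-(N : ℤ)) N,
      sqCoeff j * inner ℂ f (modulation (-j) g)) atTop (𝓝 (inner ℂ f (sqMul g))) := by
  have hfg := L2.integrable_inner (𝕜 := ℂ) f g
  have hmod : ∀ j : ℤ, inner ℂ f (modulation (-j) g)
      = ∫ x, expFun (-j) x * inner ℂ (f x) (g x) := fun j => by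
    rw [L2.inner_def]
    refine integral_congr_ae ?_
    filter_upwards [modulation_coeFn (-j) g] with x hx
    rw [hx, RCLike.inner_apply, RCLike.inner_apply, mul_assoc]
  have hint : ∀ j : ℤ, Integrable fun x => expFun (-j) x * inner ℂ (f x) (g x) := fun j =>
    hfg.bdd_mul (continuous_expFun _).aestronglyMeasurable
      (Eventually.of_forall fun x => (norm_expFun _ x).le)
  have hsum : ∀ N : ℕ, ∑ j ∈ Finset.Icc (-(N : ℤ)) N, sqCoeff j * inner ℂ f (modulation (-j) g)
      = ∫ x, sqPartial N x * inner ℂ (f x) (g x) := fun N => by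
    simp only [sqPartial, Finset.sum_mul, mul_assoc]
    rw [integral_finsetSum _ fun j _ => (hint j).const_mul _]
    refine Finset.sum_congr rfl fun j _ => ?_
    rw [hmod, integral_const_mul]
  obtain ⟨C, hC⟩ := exists_norm_sqPartial_le
  simp_rw [hsum]
  rw [inner_sqMul]
  refine tendsto_integral_of_dominated_convergence (fun x => C * ‖inner ℂ (f x) (g x)‖)
    (fun N => (continuous_sqPartial N).aestronglyMeasurable.mul hfg.aestronglyMeasurable)
    (hfg.norm.const_mul C) (fun N => Eventually.of_forall fun x => ?_)
    (Eventually.of_forall fun x => (tendsto_sqPartial x).mul_const _)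
  rw [norm_mul]
  gcongr
  exact hC N x

open FourierTransform in
/-- The Fourier multiplier with symbol `sqWave`. -/
def sqOp (f : L2R) : L2R := 𝓕⁻ (sqMul (𝓕 f))

open FourierTransform in
theorem fourier_sqOp (f : L2R) : 𝓕 (sqOp f) = sqMul (𝓕 f) := fourier_fourierInv_eq _

open FourierTransform in
theorem norm_sqOp_le (f : L2R) : ‖sqOp f‖ ≤ 2 * ‖f‖ := by
  rw [← Lp.norm_fourier_eq, fourier_sqOp, ← Lp.norm_fourier_eq f]
  exact norm_sqMul_le _

open FourierTransform in
theorem norm_le_norm_sqOp (f : L2R) : ‖f‖ ≤ ‖sqOp f‖ := by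
  rw [← Lp.norm_fourier_eq (sqOp f), fourier_sqOp, ← Lp.norm_fourier_eq f]
  exact norm_le_norm_sqMul _

open FourierTransform in
theorem inner_sqOp_sqOp (f : L2R) :
    inner ℂ (sqOp f) (sqOp f) = 3 * inner ℂ f (sqOp f) - 2 * inner ℂ f f := by
  rw [← Lp.inner_fourier_eq (sqOp f), ← Lp.inner_fourier_eq f (sqOp f),
    ← Lp.inner_fourier_eq f f, fourier_sqOp]
  exact inner_sqMul_sqMul _

open FourierTransform in
theorem tendsto_sum_inner_translation (f g : L2R) :
    Tendsto (fun N : ℕ => ∑ j ∈ Finset.Icc (-(N : ℤ)) N,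
      sqCoeff j * inner ℂ f (translation j g)) atTop (𝓝 (inner ℂ f (sqOp g))) := by
  rw [← Lp.inner_fourier_eq f, fourier_sqOp]
  refine (tendsto_sum_inner_modulation (𝓕 f) (𝓕 g)).congr fun N => ?_
  refine Finset.sum_congr rfl fun j _ => ?_
  rw [← fourier_translation, Lp.inner_fourier_eq]

/-! ### Step functions and the system of the unit box -/

theorem map_floor_volume : (volume : Measure ℝ).map Int.floor = (Measure.count : Measure ℤ) := by
  refine Measure.ext_of_singleton fun n => ?_
  rw [Measure.map_apply Int.measurable_floor (measurableSet_singleton n),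
    Int.preimage_floor_singleton, Real.volume_Ico, Measure.count_singleton]
  simp

theorem integrable_comp_floor {E : Type*} [NormedAddCommGroup E] {a : ℤ → E}
    (ha : Summable fun n => ‖a n‖) : Integrable fun x : ℝ => a ⌊x⌋ := by
  have h := integrable_count_iff.2 ha
  rw [← map_floor_volume] at h
  exact h.comp_measurable Int.measurable_floor

theorem integral_comp_floor {a : ℤ → ℂ} (ha : Summable fun n => ‖a n‖) :
    ∫ x : ℝ, a ⌊x⌋ = ∑' n, a n := by
  have h := integrable_count_iff.2 ha
  have h2 := h
  rw [← map_floor_volume] at h2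
  rw [← integral_map (f := a) Int.measurable_floor.aemeasurable h2.aestronglyMeasurable,
    map_floor_volume, integral_countable h]
  simp [Measure.real]

theorem measurable_comp_floor (a : ℤ → ℂ) : Measurable fun x : ℝ => a ⌊x⌋ :=
  (measurable_of_countable a).comp Int.measurable_floor

theorem memLp_comp_floor {a : ℤ → ℂ} (ha : Summable fun n => ‖a n‖ ^ 2) :
    MemLp (fun x : ℝ => a ⌊x⌋) 2 volume := by
  rw [memLp_two_iff_integrable_sq_norm (measurable_comp_floor a).aestronglyMeasurable]
  exact integrable_comp_floor (a := fun n => ‖a n‖ ^ 2) (by simpa using ha)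

/-- The step function in `L²(ℝ)` with value `a n` on `[n, n + 1)`. -/
def stepL2 (a : ℤ → ℂ) (ha : Summable fun n => ‖a n‖ ^ 2) : L2R := (memLp_comp_floor ha).toLp _

theorem stepL2_coeFn (a : ℤ → ℂ) (ha : Summable fun n => ‖a n‖ ^ 2) :
    stepL2 a ha =ᵐ[volume] fun x => a ⌊x⌋ :=
  (memLp_comp_floor ha).coeFn_toLp

theorem ae_comp_sub {p : ℝ → Prop} (h : ∀ᵐ x : ℝ, p x) (a : ℝ) : ∀ᵐ x : ℝ, p (x - a) :=
  (measurePreserving_sub_right volume a).quasiMeasurePreserving.ae h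

theorem whSystem_coeFn (g : L2R) (p : ℤ × ℤ) :
    whSystem g 1 1 p =ᵐ[volume] fun x => expFun p.1 x * g (x - p.2) := by
  rw [whSystem, mul_one, mul_one]
  filter_upwards [modulation_coeFn p.1 (translation p.2 g), translation_coeFn p.2 g] with x h1 h2
  rw [h1, h2]

theorem whSystem_stepL2_coeFn (a : ℤ → ℂ) (ha : Summable fun n => ‖a n‖ ^ 2) (p : ℤ × ℤ) :
    whSystem (stepL2 a ha) 1 1 p =ᵐ[volume] fun x => expFun p.1 x * a (⌊x⌋ - p.2) := by
  filter_upwards [whSystem_coeFn (stepL2 a ha) p, ae_comp_sub (stepL2_coeFn a ha) p.2]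
    with x h1 h2
  rw [h1, h2, Int.floor_sub_intCast]

theorem inner_whSystem_stepL2 (a : ℤ → ℂ) (ha : Summable fun n => ‖a n‖ ^ 2) (p : ℤ × ℤ)
    (f : L2R) :
    inner ℂ (whSystem (stepL2 a ha) 1 1 p) f
      = ∫ x, (starRingEnd ℂ) (a (⌊x⌋ - p.2)) * (expFun (-p.1) x * f x) := by
  rw [L2.inner_def]
  refine integral_congr_ae ?_
  filter_upwards [whSystem_stepL2_coeFn a ha p] with x hx
  rw [hx, RCLike.inner_apply, map_mul, conj_expFun]
  ring

theorem integrable_whSystem_stepL2 (a : ℤ → ℂ) (ha : Summable fun n => ‖a n‖ ^ 2) (p : ℤ × ℤ)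
    (f : L2R) :
    Integrable fun x => (starRingEnd ℂ) (a (⌊x⌋ - p.2)) * (expFun (-p.1) x * f x) := by
  refine (L2.integrable_inner (whSystem (stepL2 a ha) 1 1 p) f).congr ?_
  filter_upwards [whSystem_stepL2_coeFn a ha p] with x hx
  rw [hx, RCLike.inner_apply, map_mul, conj_expFun]
  ring

theorem summable_norm_sq_single :
    Summable fun n => ‖(Pi.single 0 1 : ℤ → ℂ) n‖ ^ 2 :=
  summable_of_ne_finset_zero (s := {0}) fun n hn => by
    simp at hn; simp [hn]

/-- The indicator function of `[0, 1)`. -/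
def unitBox : L2R := stepL2 (Pi.single 0 1) summable_norm_sq_single

theorem inner_whSystem_unitBox (m n : ℤ) (f : L2R) :
    inner ℂ (whSystem unitBox 1 1 (m, n)) f = ∫ x in (n : ℝ)..n + 1, expFun (-m) x * f x := by
  rw [unitBox, inner_whSystem_stepL2, intervalIntegral.integral_of_le (by linarith),
    ← integral_Ico_eq_integral_Ioc, ← integral_indicator measurableSet_Ico]
  refine integral_congr_ae (Eventually.of_forall fun x => ?_)
  simp only [Set.indicator_apply, ← Int.floor_eq_iff, Set.mem_Ico]
  by_cases h : ⌊x⌋ = n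
  · simp [h]
  · have h' : ⌊x⌋ - n ≠ 0 := sub_ne_zero.2 h
    simp [h, h']

/-- Parseval's identity for Fourier series on `[n, n + 1]`. -/
theorem hasSum_sq_inner_unitBox (n : ℤ) (f : L2R) :
    HasSum (fun m : ℤ => ‖inner ℂ (whSystem unitBox 1 1 (m, n)) f‖ ^ 2)
      (∫ x in (n : ℝ)..n + 1, ‖f x‖ ^ 2) := by
  have hab : (n : ℝ) < n + 1 := by linarith
  have h := hasSum_sq_fourierCoeffOn hab ((Lp.memLp f).restrict (Set.Ioc (n : ℝ) (n + 1)))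
  simp only [add_sub_cancel_left, inv_one, one_smul] at h
  convert! h using 2 with m
  rw [inner_whSystem_unitBox, fourierCoeffOn_eq_integral]
  simp only [fourier_coe_apply, add_sub_cancel_left, expFun, smul_eq_mul]
  simp

theorem hasSum_sq_inner_whSystem_unitBox (f : L2R) :
    HasSum (fun p : ℤ × ℤ => ‖inner ℂ (whSystem unitBox 1 1 p) f‖ ^ 2) (‖f‖ ^ 2) := by
  have hint : Integrable fun x => ‖f x‖ ^ 2 :=
    (memLp_two_iff_integrable_sq_norm (Lp.aestronglyMeasurable f)).1 (Lp.memLp f)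
  have hsum := hint.hasSum_intervalIntegral 0
  simp only [zero_add] at hsum
  have hnorm : ∫ x, ‖f x‖ ^ 2 = ‖f‖ ^ 2 := by
    rw [@norm_sq_eq_re_inner ℂ, L2.inner_def, ← integral_re (L2.integrable_inner f f)]
    refine integral_congr_ae (Eventually.of_forall fun x => ?_)
    simp only
    rw [← @norm_sq_eq_re_inner ℂ]
  rw [hnorm] at hsum
  rw [← (Equiv.prodComm ℤ ℤ).hasSum_iff]
  have hs : Summable ((fun p : ℤ × ℤ => ‖inner ℂ (whSystem unitBox 1 1 p) f‖ ^ 2)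
      ∘ Equiv.prodComm ℤ ℤ) := by
    rw [summable_prod_of_nonneg fun p => by simp only [Function.comp, Pi.zero_apply]; positivity]
    refine ⟨fun n => (hasSum_sq_inner_unitBox n f).summable, ?_⟩
    refine hsum.summable.congr fun n => ?_
    exact (hasSum_sq_inner_unitBox n f).tsum_eq.symm
  have h := hs.hasSum.prod_fiberwise fun n => hasSum_sq_inner_unitBox n f
  rw [hsum.unique h]
  exact hs.hasSum

/-! ### The window and its frame property -/

/-- The window whose Zak transform is a square wave. -/
def sqWindow : L2R := stepL2 sqCoeff summable_norm_sqCoeff_sq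

theorem inner_whSystem_unitBox_translation (m n j : ℤ) (f : L2R) :
    inner ℂ (whSystem unitBox 1 1 (m, n)) (translation j f)
      = inner ℂ (whSystem unitBox 1 1 (m, n - j)) f := by
  rw [unitBox, inner_whSystem_stepL2, inner_whSystem_stepL2]
  refine Eq.trans ?_ (integral_sub_right_eq_self _ (j : ℝ))
  refine integral_congr_ae ?_
  filter_upwards [translation_coeFn j f] with x hx
  have h1 : expFun (-m) (x - j) = expFun (-m) x := by
    rw [expFun, expFun, Complex.exp_eq_exp_iff_exists_int]
    exact ⟨m * j, by push_cast; ring⟩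
  rw [hx, h1, Int.floor_sub_intCast]
  congr 3
  ring

/-- Moving each translation in `∑ c_j T_j f` onto the unit box reassembles the window, because `conj
c_j = c_{-j}`. -/
theorem inner_whSystem_sqWindow (p : ℤ × ℤ) (f : L2R) :
    inner ℂ (whSystem sqWindow 1 1 p) f = inner ℂ (whSystem unitBox 1 1 p) (sqOp f) := by
  obtain ⟨m, n⟩ := p
  refine tendsto_nhds_unique ?_ (tendsto_sum_inner_translation _ f)
  simp_rw [inner_whSystem_unitBox_translation, unitBox, inner_whSystem_stepL2]
  -- At `x` only `j = n - ⌊x⌋` survives, so the partial sum is the shifted conjugate window cut off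
  -- at distance `N`; the uncut integrand dominates.
  have hsum : ∀ (N : ℕ) (x : ℝ), ∑ j ∈ Finset.Icc (-(N : ℤ)) N, sqCoeff j *
      (starRingEnd ℂ) ((Pi.single 0 1 : ℤ → ℂ) (⌊x⌋ - (n - j)))
      = if (n - ⌊x⌋).natAbs ≤ N then (starRingEnd ℂ) (sqCoeff (⌊x⌋ - n)) else 0 := fun N x => by
    have e : ∀ j : ℤ, sqCoeff j * (starRingEnd ℂ) ((Pi.single 0 1 : ℤ → ℂ) (⌊x⌋ - (n - j)))
        = if j = n - ⌊x⌋ then sqCoeff (n - ⌊x⌋) else 0 := fun j => by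
      by_cases h : j = n - ⌊x⌋
      · simp [h]
      · have h' : ⌊x⌋ - (n - j) ≠ 0 := fun h0 => h (by omega)
        simp [h, h']
    simp_rw [e]
    rw [Finset.sum_ite_eq']
    have : n - ⌊x⌋ ∈ Finset.Icc (-(N : ℤ)) N ↔ (n - ⌊x⌋).natAbs ≤ N := by
      rw [Finset.mem_Icc]; omega
    simp only [this]
    rw [conj_sqCoeff, neg_sub]
  have hint := integrable_whSystem_stepL2 sqCoeff summable_norm_sqCoeff_sq (m, n) f
  rw [sqWindow, inner_whSystem_stepL2]
  have hpart : ∀ N : ℕ, ∫ x, (∑ j ∈ Finset.Icc (-(N : ℤ)) N, sqCoeff j *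
      (starRingEnd ℂ) ((Pi.single 0 1 : ℤ → ℂ) (⌊x⌋ - (n - j)))) * (expFun (-m) x * f x)
      = ∑ j ∈ Finset.Icc (-(N : ℤ)) N, sqCoeff j * ∫ x,
        (starRingEnd ℂ) ((Pi.single 0 1 : ℤ → ℂ) (⌊x⌋ - (n - j))) * (expFun (-m) x * f x) := by
    intro N
    simp only [Finset.sum_mul, mul_assoc]
    rw [integral_finsetSum]
    · simp_rw [integral_const_mul]
    · intro j _
      exact (integrable_whSystem_stepL2 _ summable_norm_sq_single (m, n - j) f).const_mul _
  refine Tendsto.congr hpart ?_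
  simp_rw [hsum]
  refine tendsto_integral_of_dominated_convergence
    (fun x => ‖(starRingEnd ℂ) (sqCoeff (⌊x⌋ - n)) * (expFun (-m) x * f x)‖) (fun N => ?_)
    hint.norm (fun N => Eventually.of_forall fun x => ?_) (Eventually.of_forall fun x => ?_)
  · refine AEStronglyMeasurable.mul ?_
      ((continuous_expFun _).aestronglyMeasurable.mul (Lp.aestronglyMeasurable f))
    exact (measurable_comp_floor fun k => if (n - k).natAbs ≤ N then
      (starRingEnd ℂ) (sqCoeff (k - n)) else 0).aestronglyMeasurable
  · split_ifs
    · exact le_rfl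
    · rw [zero_mul, norm_zero]; exact norm_nonneg _
  · refine tendsto_const_nhds.congr' ?_
    filter_upwards [eventually_ge_atTop (n - ⌊x⌋).natAbs] with N hN
    rw [if_pos hN]

theorem hasSum_sq_inner_whSystem_sqWindow (f : L2R) :
    HasSum (fun p : ℤ × ℤ => ‖inner ℂ (whSystem sqWindow 1 1 p) f‖ ^ 2) (‖sqOp f‖ ^ 2) := by
  simp_rw [inner_whSystem_sqWindow]
  exact hasSum_sq_inner_whSystem_unitBox _

theorem isWHFrame_sqWindow : IsWHFrame sqWindow 1 1 := by
  refine ⟨1, 4, one_pos, by norm_num, fun f => ?_⟩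
  have h := hasSum_sq_inner_whSystem_sqWindow f
  refine ⟨h.summable, ?_, ?_⟩
  · rw [h.tsum_eq, one_mul]
    exact pow_le_pow_left₀ (norm_nonneg _) (norm_le_norm_sqOp f) 2
  · rw [h.tsum_eq]
    calc ‖sqOp f‖ ^ 2 ≤ (2 * ‖f‖) ^ 2 := pow_le_pow_left₀ (norm_nonneg _) (norm_sqOp_le f) 2
      _ = 4 * ‖f‖ ^ 2 := by ring

/-! ### The Walnut series and its symmetric summation -/

/-- The Fourier coefficients of the square of `sqWave`. -/
def sqCorr (k : ℤ) : ℂ := 3 * sqCoeff k - if k = 0 then 2 else 0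

theorem walnutTerm_sqWindow_ae (k : ℤ) : ∀ᵐ t : ℝ, ∀ n : ℤ, walnutTerm sqWindow 1 1 k t n
    = sqCoeff (⌊t⌋ - n) * (starRingEnd ℂ) (sqCoeff (⌊t⌋ - n - k)) := by
  rw [ae_all_iff]
  intro n
  have h := stepL2_coeFn sqCoeff summable_norm_sqCoeff_sq
  filter_upwards [ae_comp_sub h n, ae_comp_sub (ae_comp_sub h k) n] with t h1 h2
  rw [walnutTerm, mul_one, div_one, sqWindow, h1, h2, Int.floor_sub_intCast,
    Int.floor_sub_intCast, Int.floor_sub_intCast]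

theorem summable_walnutTerm_sqWindow (k : ℤ) :
    ∀ᵐ t : ℝ, Summable (walnutTerm sqWindow 1 1 k t) := by
  filter_upwards [walnutTerm_sqWindow_ae k] with t ht
  exact ((summable_sqCoeff_mul_conj k).comp_injective (sub_right_injective (b := ⌊t⌋))).congr
    fun n => (ht n).symm

theorem walnutG_sqWindow_ae (k : ℤ) : ∀ᵐ t : ℝ, walnutG sqWindow 1 1 k t = sqCorr k := by
  filter_upwards [walnutTerm_sqWindow_ae k] with t ht
  rw [walnutG, sqCorr, ← tsum_sqCoeff_mul_conj, tsum_congr ht]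
  exact (Equiv.subLeft ⌊t⌋).tsum_eq fun n => sqCoeff n * (starRingEnd ℂ) (sqCoeff (n - k))

theorem whIntegrand_sqWindow_ae (f : L2R) (k : ℤ) :
    whIntegrand sqWindow 1 1 f k =ᵐ[volume] fun t => sqCorr k * inner ℂ (f t) (translation k f t) := by
  filter_upwards [walnutG_sqWindow_ae k, translation_coeFn k f] with t h1 h2
  rw [whIntegrand, h1, h2, div_one, RCLike.inner_apply]
  ring

theorem integrable_whIntegrand_sqWindow (f : L2R) (k : ℤ) :
    Integrable (whIntegrand sqWindow 1 1 f k) :=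
  ((L2.integrable_inner f (translation k f)).const_mul _).congr (whIntegrand_sqWindow_ae f k).symm

theorem whPartialSum_sqWindow (f : L2R) (K L : ℕ) :
    whPartialSum sqWindow 1 1 f K L
      = ∑ k ∈ Finset.Icc (-(L : ℤ)) K, sqCorr k * inner ℂ f (translation k f) := by
  rw [whPartialSum, Complex.ofReal_one, div_one, one_mul]
  refine Finset.sum_congr rfl fun k _ => ?_
  rw [integral_congr_ae (whIntegrand_sqWindow_ae f k), integral_const_mul, L2.inner_def]

theorem translation_zero (f : L2R) : translation 0 f = f := by
  refine Lp.ext ?_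
  filter_upwards [translation_coeFn 0 f] with x hx
  rw [hx, sub_zero]

theorem whIdentitySymm_sqWindow (f : L2R) : WHIdentitySymm sqWindow 1 1 f := by
  refine ⟨‖sqOp f‖ ^ 2, hasSum_sq_inner_whSystem_sqWindow f, ?_⟩
  have h := ((tendsto_sum_inner_translation f f).const_mul 3).sub_const (2 * inner ℂ f f)
  rw [← inner_sqOp_sqOp, inner_self_eq_norm_sq_to_K (sqOp f)] at h
  push_cast
  refine h.congr fun K => ?_
  rw [whPartialSum_sqWindow]
  simp only [sqCorr, sub_mul, Finset.sum_sub_distrib, Finset.mul_sum, mul_assoc, ite_mul, zero_mul]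
  rw [Finset.sum_ite_eq', if_pos (Finset.mem_Icc.2 (by omega)), Int.cast_zero, translation_zero]

/-! ### Divergence of the one-sided sums -/

/-- Translation as a continuous linear map. -/
def translationL (a : ℝ) : L2R →L[ℂ] L2R :=
  (Lp.compMeasurePreservingₗᵢ ℂ (fun x : ℝ => x - a)
    (measurePreserving_sub_right volume a)).toContinuousLinearMap

theorem translationL_apply (a : ℝ) (f : L2R) : translationL a f = translation a f := rfl

/-- A family of operators on a complex Hilbert space with pointwise bounded quadratic forms is
uniformly bounded. -/
theorem exists_norm_le_of_inner_self_bounded {ι H : Type*} [NormedAddCommGroup H]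
    [InnerProductSpace ℂ H] [CompleteSpace H] (A : ι → H →L[ℂ] H)
    (hA : ∀ x, ∃ C : ℝ, ∀ i, ‖inner ℂ x (A i x)‖ ≤ C) : ∃ C : ℝ, ∀ i, ‖A i‖ ≤ C := by
  -- Uniform boundedness is used twice: for fixed `y`, on the functionals pairing with `A i y`,
  -- which polarization bounds pointwise, and then on the operators.
  refine banach_steinhaus fun y => ?_
  obtain ⟨C, hC⟩ : ∃ C : ℝ, ∀ i, ‖innerSL ℂ (A i y)‖ ≤ C := by
    refine banach_steinhaus fun x => ?_
    have hA' : ∀ x, ∃ C : ℝ, ∀ i, ‖inner ℂ (A i x) x‖ ≤ C := fun x => by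
      obtain ⟨C, hC⟩ := hA x
      exact ⟨C, fun i => by rw [norm_inner_symm]; exact hC i⟩
    obtain ⟨C1, h1⟩ := hA' (x + y)
    obtain ⟨C2, h2⟩ := hA' (x - y)
    obtain ⟨C3, h3⟩ := hA' (x + Complex.I • y)
    obtain ⟨C4, h4⟩ := hA' (x - Complex.I • y)
    refine ⟨(C1 + C2 + C3 + C4) / 4, fun i => ?_⟩
    rw [innerSL_apply_apply]
    have hp := inner_map_polarization (A i : H →ₗ[ℂ] H) x y
    simp only [ContinuousLinearMap.coe_coe] at hp
    rw [hp, norm_div, Complex.norm_ofNat]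
    gcongr
    refine (norm_sub_le _ _).trans (add_le_add ((norm_add_le _ _).trans
      (add_le_add ((norm_sub_le _ _).trans (add_le_add (h1 i) (h2 i))) ?_)) ?_)
    · rw [norm_mul, Complex.norm_I, one_mul]; exact h3 i
    · rw [norm_mul, Complex.norm_I, one_mul]; exact h4 i
  exact ⟨C, fun i => by rw [← innerSL_apply_norm (𝕜 := ℂ)]; exact hC i⟩

/-- The one-sided partial sums of the Walnut series as operators. -/
def oneSidedOp (K : ℕ) : L2R →L[ℂ] L2R :=
  ∑ k ∈ Finset.range K, sqCorr (k + 1) • translationL ((k + 1 : ℤ) : ℝ)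

theorem inner_oneSidedOp (K : ℕ) (f : L2R) :
    inner ℂ f (oneSidedOp K f) = ∑ k ∈ Finset.range K,
      sqCorr (k + 1) * inner ℂ f (translation ((k + 1 : ℤ) : ℝ) f) := by
  rw [oneSidedOp, sum_apply, inner_sum]
  refine Finset.sum_congr rfl fun k _ => ?_
  rw [smul_apply, inner_smul_right, translationL_apply]

theorem whPartialSum_sub_whPartialSum (f : L2R) (K L : ℕ) :
    whPartialSum sqWindow 1 1 f K L - whPartialSum sqWindow 1 1 f 0 L
      = inner ℂ f (oneSidedOp K f) := by
  rw [inner_oneSidedOp]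
  induction K with
  | zero => simp
  | succ K ih =>
    rw [Finset.sum_range_succ, ← ih, whPartialSum_sqWindow, whPartialSum_sqWindow,
      whPartialSum_sqWindow]
    have e : Finset.Icc (-(L : ℤ)) ((K + 1 : ℕ) : ℤ)
        = insert ((K : ℤ) + 1) (Finset.Icc (-(L : ℤ)) K) := by
      ext x; simp only [Finset.mem_Icc, Finset.mem_insert]; omega
    rw [e, Finset.sum_insert (by simp)]
    ring

theorem exists_norm_inner_oneSidedOp_le {f : L2R} (hf : WHSeriesConverges sqWindow 1 1 f) :
    ∃ C : ℝ, ∀ K, ‖inner ℂ f (oneSidedOp K f)‖ ≤ C := by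
  obtain ⟨l, hl⟩ := hf
  -- Independence of the two limits allows the lower end to be frozen at `N` while `K` grows.
  obtain ⟨N, hN⟩ : ∃ N : ℕ, ∀ K ≥ N, ‖whPartialSum sqWindow 1 1 f K N - l‖ < 1 := by
    have h := (Metric.tendsto_nhds.1 hl) 1 one_pos
    rw [prod_atTop_atTop_eq, eventually_atTop] at h
    obtain ⟨⟨a, b⟩, hab⟩ := h
    refine ⟨max a b, fun K hK => ?_⟩
    rw [← dist_eq_norm]
    exact hab (K, max a b) ⟨(le_max_left a b).trans hK, le_max_right a b⟩
  have hb : IsBoundedUnder (· ≤ ·) atTop fun K => ‖inner ℂ f (oneSidedOp K f)‖ := by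
    refine ⟨1 + ‖l - whPartialSum sqWindow 1 1 f 0 N‖, ?_⟩
    rw [eventually_map]
    filter_upwards [eventually_ge_atTop N] with K hK
    rw [← whPartialSum_sub_whPartialSum f K N, ← sub_add_sub_cancel _ l]
    exact (norm_add_le _ _).trans (by gcongr; exact (hN K hK).le)
  obtain ⟨C, hC⟩ := hb.bddAbove_range
  exact ⟨C, fun K => hC ⟨K, rfl⟩⟩

/-- The indicator sequence of `{0, …, N - 1}`. -/
def boxSeq (N : ℕ) (n : ℤ) : ℂ := if n ∈ Finset.Ico (0 : ℤ) N then 1 else 0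

theorem boxSeq_eq_zero {N : ℕ} {n : ℤ} (h : n ∉ Finset.Ico (0 : ℤ) N) : boxSeq N n = 0 := if_neg h

theorem summable_norm_boxSeq_sq (N : ℕ) : Summable fun n => ‖boxSeq N n‖ ^ 2 :=
  summable_of_ne_finset_zero (s := Finset.Ico (0 : ℤ) N) fun n hn => by simp [boxSeq_eq_zero hn]

/-- The interval `[0, N)` and its shift by `k` overlap in length `N - k`. -/
theorem inner_box_translation {N k : ℕ} (hk : k ≤ N) :
    inner ℂ (stepL2 (boxSeq N) (summable_norm_boxSeq_sq N))
      (translation ((k : ℤ) : ℝ) (stepL2 (boxSeq N) (summable_norm_boxSeq_sq N))) = N - k := by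
  have h := stepL2_coeFn (boxSeq N) (summable_norm_boxSeq_sq N)
  have h1 : ∀ n ∉ Finset.Ico (0 : ℤ) N, boxSeq N (n - k) * (starRingEnd ℂ) (boxSeq N n) = 0 :=
    fun n hn => by rw [boxSeq_eq_zero hn, map_zero, mul_zero]
  rw [L2.inner_def]
  calc _ = ∫ x : ℝ, (fun n : ℤ => boxSeq N (n - k) * (starRingEnd ℂ) (boxSeq N n)) ⌊x⌋ := by
        refine integral_congr_ae ?_
        filter_upwards [h, translation_coeFn ((k : ℤ) : ℝ) (stepL2 (boxSeq N) _),
          ae_comp_sub h ((k : ℤ) : ℝ)] with x h1 h2 h3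
        rw [h2, h3, h1, RCLike.inner_apply, Int.floor_sub_intCast]
    _ = ∑ n ∈ Finset.Ico (0 : ℤ) N, boxSeq N (n - k) * (starRingEnd ℂ) (boxSeq N n) := by
        rw [integral_comp_floor (a := fun n : ℤ =>
            boxSeq N (n - k) * (starRingEnd ℂ) (boxSeq N n)) (summable_of_ne_finset_zero
          (s := Finset.Ico (0 : ℤ) N) fun n hn => by rw [h1 n hn, norm_zero]),
          tsum_eq_sum h1]
    _ = ∑ n ∈ Finset.Ico (k : ℤ) N, 1 := by
        trans ∑ n ∈ Finset.Ico (k : ℤ) N, boxSeq N (n - k) * (starRingEnd ℂ) (boxSeq N n)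
        swap
        · refine Finset.sum_congr rfl fun n hn => ?_
          rw [Finset.mem_Ico] at hn
          rw [boxSeq, boxSeq, if_pos (Finset.mem_Ico.2 (by omega)),
            if_pos (Finset.mem_Ico.2 (by omega))]
          simp
        refine (Finset.sum_subset ?_ ?_).symm
        · intro n hn
          rw [Finset.mem_Ico] at hn ⊢
          omega
        · intro n hn0 hn
          rw [Finset.mem_Ico] at hn hn0
          rw [boxSeq_eq_zero (n := n - k) (by rw [Finset.mem_Ico]; omega), zero_mul]
    _ = N - k := by
        rw [Finset.sum_const, Int.card_Ico, nsmul_one]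
        have : ((N : ℤ) - k).toNat = N - k := by omega
        rw [this, Nat.cast_sub hk]

/-- These imaginary parts are all nonnegative, so no cancellation occurs in the one-sided sums. -/
theorem im_sqCorr_natCast_succ (k : ℕ) :
    (sqCorr (k + 1)).im = 3 / Real.pi * if Even k then 1 / ((k : ℝ) + 1) else 0 := by
  have h0 : (k + 1 : ℤ) ≠ 0 := by omega
  rw [sqCorr, if_neg h0, sub_zero, sqCoeff, if_neg h0]
  by_cases h : Even k
  · have ho : Odd (k + 1 : ℤ) := by exact_mod_cast h.add_one
    rw [if_pos ho, if_pos h]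
    have e : 3 * (Complex.I / (Real.pi * ((k + 1 : ℤ) : ℂ)))
      = ((3 / Real.pi * (1 / ((k : ℝ) + 1)) : ℝ) : ℂ) * Complex.I := by
      push_cast; field_simp
    rw [e, Complex.im_ofReal_mul, Complex.I_im, mul_one]
  · have ho : ¬ Odd (k + 1 : ℤ) := by
      rw [Int.not_odd_iff_even]; exact_mod_cast (Nat.not_even_iff_odd.1 h).add_one
    rw [if_neg ho, if_neg h]; simp

theorem sum_range_even_one_div (M : ℕ) :
    (∑ j ∈ Finset.range M, 1 / ((j : ℝ) + 1)) / 2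
      ≤ ∑ k ∈ Finset.range (2 * M), if Even k then 1 / ((k : ℝ) + 1) else 0 := by
  induction M with
  | zero => simp
  | succ M ih =>
    rw [show 2 * (M + 1) = 2 * M + 1 + 1 by ring, Finset.sum_range_succ, Finset.sum_range_succ,
      Finset.sum_range_succ, if_pos (by simp), if_neg (by simp), add_zero, add_div]
    refine add_le_add ih ?_
    rw [div_div]
    refine one_div_le_one_div_of_le (by positivity) ?_
    push_cast; linarith

theorem exists_not_whSeriesConverges : ∃ h : L2R, ¬ WHSeriesConverges sqWindow 1 1 h := by
  by_contra! hall
  obtain ⟨C, hC⟩ := exists_norm_le_of_inner_self_bounded oneSidedOp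
    fun f => exists_norm_inner_oneSidedOp_le (hall f)
  have key : ∀ M : ℕ, 0 < M →
      3 / Real.pi * ((∑ j ∈ Finset.range M, 1 / ((j : ℝ) + 1)) / 2) ≤ 2 * C := fun M hM => by
    have hM' : (0 : ℝ) < M := by exact_mod_cast hM
    -- With length `4M` and shifts up to `2M`, every overlap is at least `2M`, half of `‖u‖²`;
    -- dividing by `2M` leaves `2 * C`.
    set u : L2R := stepL2 (boxSeq (4 * M)) (summable_norm_boxSeq_sq (4 * M)) with hu
    have hnorm : ‖u‖ ^ 2 = 4 * M := by
      have h := inner_box_translation (N := 4 * M) (k := 0) (by omega)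
      rw [← hu, Nat.cast_zero, Int.cast_zero, translation_zero, inner_self_eq_norm_sq_to_K] at h
      have h' : ((‖u‖ ^ 2 : ℝ) : ℂ) = ((4 * M : ℝ) : ℂ) := by push_cast at h ⊢; simpa using h
      exact_mod_cast h'
    have hle : ‖inner ℂ u (oneSidedOp (2 * M) u)‖ ≤ C * (4 * M) := by
      calc _ ≤ ‖u‖ * ‖oneSidedOp (2 * M) u‖ := norm_inner_le_norm _ _
        _ ≤ ‖u‖ * (C * ‖u‖) := by gcongr; exact (oneSidedOp (2 * M)).le_of_opNorm_le (hC _) u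
        _ = C * (4 * M) := by rw [← hnorm]; ring
    have him : (inner ℂ u (oneSidedOp (2 * M) u)).im = ∑ k ∈ Finset.range (2 * M),
        (3 / Real.pi * if Even k then 1 / ((k : ℝ) + 1) else 0) * (4 * M - (k + 1)) := by
      rw [inner_oneSidedOp, Complex.im_sum]
      refine Finset.sum_congr rfl fun k hk => ?_
      rw [Finset.mem_range] at hk
      have h := inner_box_translation (N := 4 * M) (k := k + 1) (by omega)
      rw [← hu] at h
      push_cast at h ⊢
      rw [h, ← im_sqCorr_natCast_succ]
      have e : (4 * (M : ℂ) - (k + 1)) = ((4 * M - (k + 1) : ℝ) : ℂ) := by push_cast; ring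
      rw [e, Complex.im_mul_ofReal]
    have hge : 3 / Real.pi * ((∑ j ∈ Finset.range M, 1 / ((j : ℝ) + 1)) / 2) * (2 * M)
        ≤ (inner ℂ u (oneSidedOp (2 * M) u)).im := by
      rw [him]
      calc _ ≤ 3 / Real.pi * (∑ k ∈ Finset.range (2 * M), if Even k then 1 / ((k : ℝ) + 1) else 0)
            * (2 * M) := by
            gcongr; exact sum_range_even_one_div M
        _ ≤ _ := by
            rw [Finset.mul_sum, Finset.sum_mul]
            refine Finset.sum_le_sum fun k hk => ?_
            rw [Finset.mem_range] at hk
            have hk' : (k : ℝ) + 1 ≤ 2 * M := by exact_mod_cast hk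
            gcongr
            linarith
    have h := hge.trans ((Complex.abs_im_le_norm _).trans' (le_abs_self _) |>.trans hle)
    have h2 : 3 / Real.pi * ((∑ j ∈ Finset.range M, 1 / ((j : ℝ) + 1)) / 2) * (2 * M)
        ≤ (2 * C) * (2 * M) := h.trans_eq (by ring)
    exact le_of_mul_le_mul_right h2 (by positivity)
  have htop := Real.tendsto_sum_range_one_div_nat_succ_atTop
  have htop' := (htop.atTop_div_const two_pos).const_mul_atTop
    (show (0 : ℝ) < 3 / Real.pi by positivity)
  obtain ⟨M, hM, hM0⟩ := ((htop'.eventually_gt_atTop (2 * C)).and (eventually_gt_atTop 0)).exists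
  exact absurd (key M hM0) (not_le.2 hM)

end

theorem mainTheorem8 :
    ∃ g : L2R, IsWHFrame g 1 1 ∧
      -- the functions `G_k` and the terms of the right hand side are well defined
      (∀ k : ℤ, ∀ᵐ t : ℝ, Summable (walnutTerm g 1 1 k t)) ∧
      (∀ (f : L2R) (k : ℤ), Integrable (whIntegrand g 1 1 f k)) ∧
      (∀ f : L2R, WHIdentitySymm g 1 1 f) ∧
      ∃ h : L2R, ¬ WHSeriesConverges g 1 1 h :=
  ⟨sqWindow, isWHFrame_sqWindow, summable_walnutTerm_sqWindow, integrable_whIntegrand_sqWindow,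
    whIdentitySymm_sqWindow, exists_not_whSeriesConverges⟩
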